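/- For a totally real number field $K$, write $\mathcal{O}_K$ for its ring of integers, and let $\mathcal{O}_K^+$ be the set of totally positive elements of $\mathcal{O}_K$, that is, of those $\alpha\in\mathcal{O}_K$ with $\sigma(\alpha)>0$ for every embedding $\sigma:K\to\mathbb{R}$. Fix a squarefree integer $D>1$. There are real constants $c_1,c_2,c_3>0$, depending only on $D$, such that for every totally real number field $K$ with $[K:\mathbb{Q}]=4$ and $\sqrt D\in K$, with discriminant $\Delta$, the following hold. (a) There is $\alpha\in\mathcal{O}_K^+\setminus\mathbb{Q}(\sqrt D)$ with $$c_1\,\Delta^{1/4}<\mathrm{Tr}_{K/\mathbb{Q}}(\alpha)<c_2\,\Delta^{1/4}.$$ (b) For every $\beta\in\mathcal{O}_K\setminus\mathbb{Q}(\sqrt D)$, $$\mathrm{Tr}_{K/\mathbb{Q}}(\beta^2)>c_3\,\Delta^{1/2}.$$ -/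

import Mathlib

open NumberField IntermediateField

universe u

/-- `α` is totally positive: it is positive under every real embedding of `K` (which, for a totally
real field, are all the embeddings of `K` into `ℂ`). -/
def IsTotallyPositive {K : Type*} [Field K] (α : K) : Prop :=
  ∀ φ : K →+* ℝ, 0 < φ α

open Module

/-! For (b), `1, √D, β, √D β` are independent integers of `K`, so their discriminant is a nonzero
square multiple of `Δ`. It is also the square of a 4×4 determinant of conjugates, which are bounded
in terms of `D` and `t = Tr(β²)`; this gives `√Δ ≤ 24 D t` (`sqrt_discr_le_trace_sq`).

For (a), Minkowski's theorem is applied to a box with side bound 1 at one place for each sign of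
`√D`, and of order `Δ^(1/4)` at the other two (`exists_notMem_adjoin_forall_lt`). A nonzero integer
of `ℚ(√D)` in the box would have all conjugates below 1, which is impossible. Adding a natural
number makes the point totally positive; the lower trace bound then follows from (b). -/

theorem sq_ne_of_squarefree {D : ℤ} (hD1 : 1 < D) (hD : Squarefree D) (q : ℚ) :
    q ^ 2 ≠ (D : ℚ) := by
  intro h
  have h1 : IsSquare (D : ℚ) := ⟨q, by rw [← h, sq]⟩
  rw [Rat.isSquare_intCast_iff] at h1
  obtain ⟨r, rfl⟩ := h1
  have := hD r (dvd_refl _)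
  rcases Int.isUnit_iff.mp this with rfl | rfl <;> simp at hD1

/-! ### Linear independence over `ℚ` -/

section Field

variable {K : Type*} [Field K] [CharZero K]

theorem eq_zero_of_ratCast_add_mul_eq_zero {D : ℤ} (hD1 : 1 < D) (hD : Squarefree D) {s : K}
    (hs : s ^ 2 = (D : K)) {x y : ℚ} (h : (x : K) + y * s = 0) : x = 0 ∧ y = 0 := by
  have hy : y = 0 := by
    by_contra hy
    have hy' : (y : K) ≠ 0 := by exact_mod_cast hy
    have h1 : s = ((-x / y : ℚ) : K) := by
      push_cast
      field_simp
      linear_combination h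
    rw [h1] at hs
    exact sq_ne_of_squarefree hD1 hD (-x / y) (by exact_mod_cast hs)
  subst hy
  exact ⟨by simpa using h, rfl⟩

theorem linearIndependent_one_mul {D : ℤ} (hD1 : 1 < D) (hD : Squarefree D) {s β : K}
    (hs : s ^ 2 = (D : K)) (hβ : β ∉ ℚ⟮s⟯) : LinearIndependent ℚ ![1, s, β, s * β] := by
  have hmem : ∀ x y : ℚ, (x : K) + y * s ∈ ℚ⟮s⟯ := fun x y =>
    add_mem (SubfieldClass.ratCast_mem ℚ⟮s⟯ x) (mul_mem (SubfieldClass.ratCast_mem ℚ⟮s⟯ y) (mem_adjoin_simple_self ℚ s))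
  rw [Fintype.linearIndependent_iff]
  intro g hg
  simp only [Fin.sum_univ_four, Matrix.cons_val, Rat.smul_def] at hg
  have h0 : ((g 2 : K) + g 3 * s) = 0 := by
    by_contra hne
    apply hβ
    have : β = -((g 0 : K) + g 1 * s) / ((g 2 : K) + g 3 * s) := by
      rw [eq_div_iff hne]
      linear_combination hg
    rw [this]
    exact div_mem (neg_mem (hmem _ _)) (hmem _ _)
  have h1 : ((g 0 : K) + g 1 * s) = 0 := by linear_combination hg - β * h0
  obtain ⟨a, b⟩ := eq_zero_of_ratCast_add_mul_eq_zero hD1 hD hs h0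
  obtain ⟨c, d⟩ := eq_zero_of_ratCast_add_mul_eq_zero hD1 hD hs h1
  intro i
  fin_cases i <;> assumption

end Field

/-- Each Leibniz term takes exactly one entry from every row. -/
theorem Matrix.norm_det_le_of_forall_le {n : Type*} [Fintype n] [DecidableEq n]
    (M : Matrix n n ℂ) (b : n → ℝ) (h : ∀ i j, ‖M i j‖ ≤ b i) :
    ‖M.det‖ ≤ (Fintype.card n).factorial * ∏ i, b i := by
  rw [← Matrix.det_transpose, Matrix.det_apply]
  refine (norm_sum_le _ _).trans ?_
  rw [← Fintype.card_perm, ← nsmul_eq_mul]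
  refine Finset.sum_le_card_nsmul _ _ _ fun σ _ => ?_
  have hsign : ‖Equiv.Perm.sign σ • ∏ i, M.transpose (σ i) i‖ = ‖∏ i, M.transpose (σ i) i‖ := by
    rcases Int.units_eq_one_or (Equiv.Perm.sign σ) with h | h <;> simp [h]
  rw [hsign, norm_prod]
  exact Finset.prod_le_prod (fun _ _ => norm_nonneg _) fun i _ => h _ _

/-! ### Discriminants, traces and embeddings -/

section NumberField

variable {K : Type*} [Field K] [NumberField K]

/-- The two discriminants differ by the square of the determinant of `v` in an integral basis, a
nonzero integer. -/
theorem NumberField.abs_discr_le_abs_discr {ι : Type*} [Fintype ι] [DecidableEq ι]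
    (v : ι → 𝓞 K) (hcard : Fintype.card ι = finrank ℚ K)
    (hv : LinearIndependent ℚ fun i => (v i : K)) :
    (|discr K| : ℚ) ≤ |Algebra.discr ℚ fun i => (v i : K)| := by
  have hc : Fintype.card (Free.ChooseBasisIndex ℤ (𝓞 K)) = Fintype.card ι := by
    rw [← finrank_eq_card_chooseBasisIndex, RingOfIntegers.rank, hcard]
  let b := (RingOfIntegers.basis K).reindex (Fintype.equivOfCardEq hc)
  have h1 : Algebra.discr ℤ v = (b.toMatrix v).det ^ 2 * discr K := by
    rw [← discr_eq_discr K b, ← Algebra.discr_of_matrix_vecMul, Basis.toMatrix_map_vecMul]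
  have h2 : (Algebra.discr ℚ fun i => (v i : K)) = (Algebra.discr ℤ v : ℤ) := by
    rw [Algebra.discr_def, Algebra.discr_def, ← eq_intCast (algebraMap ℤ ℚ), RingHom.map_det]
    congr 1
    ext i j
    simp only [Algebra.traceMatrix_apply, Algebra.traceForm_apply, RingHom.mapMatrix_apply,
      Matrix.map_apply]
    rw [← map_mul, eq_intCast, Algebra.coe_trace_int]
  have h3 : (Algebra.discr ℚ fun i => (v i : K)) ≠ 0 := by
    have : Nonempty ι := Fintype.card_pos_iff.mp (by rw [hcard]; exact finrank_pos)
    simpa using Algebra.discr_not_zero_of_basis ℚ (basisOfLinearIndependentOfCardEqFinrank hv hcard)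
  have h4 : (b.toMatrix v).det ≠ 0 := by
    intro h
    rw [h2, h1, h] at h3
    simp at h3
  rw [h2, h1]
  rw [Int.cast_mul, Int.cast_pow, abs_mul, abs_of_nonneg (sq_nonneg ((b.toMatrix v).det : ℚ))]
  refine le_mul_of_one_le_left (abs_nonneg _) ?_
  have := sq_pos_of_ne_zero h4
  exact_mod_cast this

theorem NumberField.trace_eq_sum_re (x : K) :
    ((Algebra.trace ℚ K x : ℚ) : ℝ) = ∑ σ : K →ₐ[ℚ] ℂ, (σ x).re := by
  have h := trace_eq_sum_embeddings ℂ (K := ℚ) (L := K) (x := x)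
  have := congrArg Complex.re h
  simpa using this

theorem norm_map_eq_sqrt {D : ℤ} (hD1 : 1 < D) {s : K} (hs : s ^ 2 = (D : K)) (σ : K →ₐ[ℚ] ℂ) :
    ‖σ s‖ = √D := by
  have h : σ s ^ 2 = (D : ℂ) := by rw [← map_pow, hs, map_intCast]
  have h2 : ‖σ s‖ ^ 2 = D := by
    rw [← norm_pow, h, Complex.norm_intCast, abs_of_pos (by exact_mod_cast (by lia : 0 < D))]
  rw [← h2, Real.sqrt_sq (norm_nonneg _)]

theorem exists_embedding_apply_eq {D : ℤ} (hD1 : 1 < D) (hD : Squarefree D) {s : K}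
    (hs : s ^ 2 = (D : K)) {z : ℂ} (hz : z ^ 2 = (D : ℂ)) : ∃ φ : K →+* ℂ, φ s = z := by
  have hirr : Irreducible (Polynomial.X ^ 2 - Polynomial.C (D : ℚ)) := by
    rw [X_pow_sub_C_irreducible_iff_of_prime Nat.prime_two]
    exact sq_ne_of_squarefree hD1 hD
  have hmin := minpoly.eq_of_irreducible_of_monic hirr (x := s) (by simp [hs])
    (Polynomial.monic_X_pow_sub_C _ two_ne_zero)
  have hmem : z ∈ (minpoly ℚ s).rootSet ℂ := by
    rw [Polynomial.mem_rootSet]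
    exact ⟨minpoly.ne_zero (Algebra.IsIntegral.isIntegral s), by simp [← hmin, hz]⟩
  rw [← Embeddings.range_eval_eq_rootSet_minpoly] at hmem
  exact hmem

theorem map_eq_of_mem_adjoin {φ ψ : K →+* ℂ} {s a : K} (h : φ s = ψ s) (ha : a ∈ ℚ⟮s⟯) :
    φ a = ψ a := by
  induction ha using IntermediateField.adjoin_induction with
  | mem x hx => rw [Set.mem_singleton_iff.mp hx, h]
  | algebraMap x => simp
  | add x y _ _ hx hy => rw [map_add, map_add, hx, hy]
  | inv x _ hx => rw [map_inv₀, map_inv₀, hx]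
  | mul x y _ _ hx hy => rw [map_mul, map_mul, hx, hy]

variable [IsTotallyReal K]

theorem NumberField.IsTotallyReal.ofReal_re_apply (σ : K →ₐ[ℚ] ℂ) (x : K) :
    (((σ x).re : ℝ) : ℂ) = σ x := by
  have h := IsTotallyReal.complexEmbedding_isReal (σ : K →+* ℂ)
  have := RingHom.congr_fun h x
  exact Complex.conj_eq_iff_re.mp this

theorem NumberField.IsTotallyReal.trace_sq (x : K) :
    ((Algebra.trace ℚ K (x ^ 2) : ℚ) : ℝ) = ∑ σ : K →ₐ[ℚ] ℂ, (σ x).re ^ 2 := by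
  rw [trace_eq_sum_re]
  refine Finset.sum_congr rfl fun σ _ => ?_
  rw [map_pow, ← IsTotallyReal.ofReal_re_apply σ x]
  norm_cast

theorem NumberField.IsTotallyReal.norm_apply_sq_le_trace (σ : K →ₐ[ℚ] ℂ) (x : K) :
    ‖σ x‖ ^ 2 ≤ ((Algebra.trace ℚ K (x ^ 2) : ℚ) : ℝ) := by
  rw [IsTotallyReal.trace_sq, ← IsTotallyReal.ofReal_re_apply σ x, Complex.norm_real,
    Real.norm_eq_abs, sq_abs]
  exact Finset.single_le_sum (f := fun τ : K →ₐ[ℚ] ℂ => (τ x).re ^ 2)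
    (fun _ _ => sq_nonneg _) (Finset.mem_univ σ)

theorem NumberField.IsTotallyReal.discr_pos : 0 < discr K := by
  rw [← Int.sign_eq_one_iff_pos, sign_discr, IsTotallyReal.nrComplexPlaces_eq_zero, pow_zero]

/-! ### Lower bound for the trace of a square -/

theorem sqrt_discr_le_trace_sq {D : ℤ} (hD1 : 1 < D) (hD : Squarefree D) (h4 : finrank ℚ K = 4)
    {s : K} (hs : s ^ 2 = (D : K)) (β : 𝓞 K) (hβ : (β : K) ∉ ℚ⟮s⟯) :
    √(discr K) ≤ 24 * D * ((Algebra.trace ℚ K ((β : K) ^ 2) : ℚ) : ℝ) := by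
  set t := ((Algebra.trace ℚ K ((β : K) ^ 2) : ℚ) : ℝ) with ht
  have ht0 : 0 ≤ t := by
    rw [ht, IsTotallyReal.trace_sq]
    positivity
  have hD0 : (0 : ℝ) ≤ D := by exact_mod_cast (by lia : 0 ≤ D)
  have hsint : IsIntegral ℤ s := .of_pow two_pos (hs ▸ isIntegral_algebraMap (R := ℤ) (x := D))
  let s' : 𝓞 K := ⟨s, hsint⟩
  have hvec : (fun i => ((![1, s', β, s' * β] : Fin 4 → 𝓞 K) i : K))
      = ![1, s, (β : K), s * β] := by
    ext i
    fin_cases i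
    · simp
    · rfl
    · simp
    · simp only [Fin.reduceFinMk, Matrix.cons_val, map_mul]
      rfl
  have hle := abs_discr_le_abs_discr ![1, s', β, s' * β] (by simp [h4])
    (by rw [hvec]; exact linearIndependent_one_mul hD1 hD hs hβ)
  rw [hvec] at hle
  let e : Fin 4 ≃ (K →ₐ[ℚ] ℂ) := Fintype.equivOfCardEq (by
    rw [AlgHom.card, h4, Fintype.card_fin])
  have hdet := Algebra.discr_eq_det_embeddingsMatrixReindex_pow_two ℚ ℂ ![1, s, (β : K), s * β] e
  have hbd : ‖(Algebra.embeddingsMatrixReindex ℚ ℂ ![1, s, (β : K), s * β] e).det‖ ≤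
      24 * D * t := by
    refine (Matrix.norm_det_le_of_forall_le _ ![1, √D, √t, √D * √t] ?_).trans ?_
    · intro i j
      have hβ' : ‖e j β‖ ≤ √t := Real.le_sqrt_of_sq_le (IsTotallyReal.norm_apply_sq_le_trace _ _)
      have hs' := (norm_map_eq_sqrt hD1 hs (e j)).le
      fin_cases i
      · simp [Algebra.embeddingsMatrixReindex, Algebra.embeddingsMatrix]
      · simpa [Algebra.embeddingsMatrixReindex, Algebra.embeddingsMatrix] using hs'
      · simpa [Algebra.embeddingsMatrixReindex, Algebra.embeddingsMatrix] using hβ'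
      · simpa [Algebra.embeddingsMatrixReindex, Algebra.embeddingsMatrix] using
          mul_le_mul hs' hβ' (norm_nonneg _) (Real.sqrt_nonneg _)
    · simp only [Fin.prod_univ_four, Matrix.cons_val, Fintype.card_fin, Nat.factorial]
      push_cast
      refine le_of_eq ?_
      linear_combination 24 * √t ^ 2 * Real.sq_sqrt hD0 + 24 * D * Real.sq_sqrt ht0
  refine Real.sqrt_le_iff.mpr ⟨by positivity, ?_⟩
  have h5 : ((|Algebra.discr ℚ ![1, s, (β : K), s * β]| : ℚ) : ℝ) =
      ‖(Algebra.embeddingsMatrixReindex ℚ ℂ ![1, s, (β : K), s * β] e).det‖ ^ 2 := by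
    rw [← norm_pow, ← hdet, eq_ratCast, Complex.norm_ratCast, Rat.cast_abs]
  have h6 : (discr K : ℝ) ≤ ((|Algebra.discr ℚ ![1, s, (β : K), s * β]| : ℚ) : ℝ) := by
    have : (discr K : ℚ) ≤ |Algebra.discr ℚ ![1, s, (β : K), s * β]| := (le_abs_self _).trans hle
    exact_mod_cast this
  rw [h5] at h6
  exact h6.trans (by gcongr)

/-- Doubling 24 to 48 makes the inequality strict, as `Δ > 0`. -/
theorem discr_rpow_lt_trace_sq {D : ℤ} (hD1 : 1 < D) (hD : Squarefree D) (h4 : finrank ℚ K = 4)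
    {s : K} (hs : s ^ 2 = (D : K)) (β : 𝓞 K) (hβ : (β : K) ∉ ℚ⟮s⟯) :
    1 / (48 * D) * (discr K : ℝ) ^ (1 / 2 : ℝ) <
      ((Algebra.trace ℚ K ((β : K) ^ 2) : ℚ) : ℝ) := by
  have h := sqrt_discr_le_trace_sq hD1 hD h4 hs β hβ
  have hD0 : (0 : ℝ) < D := by exact_mod_cast (by lia : 0 < D)
  have hpos : 0 < √(discr K : ℝ) :=
    Real.sqrt_pos.mpr (by exact_mod_cast IsTotallyReal.discr_pos (K := K))
  rw [← Real.sqrt_eq_rpow, one_div_mul_eq_div, div_lt_iff₀ (by positivity)]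
  linarith

/-! ### Small elements from Minkowski's theorem -/

open scoped Classical in
theorem NumberField.IsTotallyReal.exists_lt_of_sqrt_discr_lt_prod
    (f : InfinitePlace K → NNReal) (hf : √(discr K : ℝ) < ∏ w, (f w : ℝ)) :
    ∃ a : 𝓞 K, a ≠ 0 ∧ ∀ w : InfinitePlace K, w (a : K) < f w := by
  apply mixedEmbedding.exists_ne_zero_mem_ringOfIntegers_lt
  have h1 : NNReal.sqrt ‖discr K‖₊ < ∏ w, f w := by
    rw [← NNReal.coe_lt_coe, NNReal.coe_prod, Real.coe_sqrt, coe_nnnorm, Int.norm_eq_abs,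
      abs_of_pos (by exact_mod_cast IsTotallyReal.discr_pos (K := K))]
    exact hf
  rw [mixedEmbedding.minkowskiBound, mixedEmbedding.convexBodyLT_volume,
    mixedEmbedding.volume_fundamentalDomain_fractionalIdealLatticeBasis,
    mixedEmbedding.volume_fundamentalDomain_latticeBasis, mixedEmbedding.finrank,
    mixedEmbedding.convexBodyLTFactor, IsTotallyReal.nrComplexPlaces_eq_zero, IsTotallyReal.finrank]
  simp only [IsTotallyReal.mult_eq, pow_one, pow_zero, mul_one, one_mul, Units.val_one, map_one,
    Rat.cast_one, ENNReal.ofReal_one, ENNReal.coe_pow, ENNReal.coe_ofNat]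
  -- With no complex places, the Minkowski bound and the box volume share the factor `2 ^ n`, which
  -- cancels.
  rw [mul_comm]
  refine (ENNReal.mul_lt_mul_iff_right (by simp) (by simp)).mpr ?_
  exact_mod_cast h1

theorem exists_notMem_adjoin_forall_lt {D : ℤ} (hD1 : 1 < D) (hD : Squarefree D)
    (h4 : finrank ℚ K = 4) {s : K} (hs : s ^ 2 = (D : K)) :
    ∃ a : 𝓞 K, (a : K) ∉ ℚ⟮s⟯ ∧
      ∀ w : InfinitePlace K, w (a : K) < 2 * (discr K : ℝ) ^ (1 / 4 : ℝ) := by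
  classical
  have hD0 : (0 : ℝ) < D := by exact_mod_cast (by lia : 0 < D)
  have hΔ : (1 : ℝ) ≤ discr K := by exact_mod_cast IsTotallyReal.discr_pos (K := K)
  -- The factor 2 gives both `T² > √Δ` and, since `Δ ≥ 1`, `T > 1`, so that `T` bounds every side.
  set T : NNReal := ⟨2 * (discr K : ℝ) ^ (1 / 4 : ℝ), by positivity⟩ with hT
  have hT1 : (1 : ℝ) < T := by
    have : (1 : ℝ) ≤ (discr K : ℝ) ^ (1 / 4 : ℝ) := Real.one_le_rpow hΔ (by norm_num)
    change (1 : ℝ) < 2 * (discr K : ℝ) ^ (1 / 4 : ℝ)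
    linarith
  have hTsq : √(discr K : ℝ) < (T : ℝ) ^ 2 := by
    have h : √(discr K : ℝ) = ((discr K : ℝ) ^ (1 / 4 : ℝ)) ^ 2 := by
      rw [Real.sqrt_eq_rpow, ← Real.rpow_natCast, ← Real.rpow_mul (by linarith)]
      norm_num
    change √(discr K : ℝ) < (2 * (discr K : ℝ) ^ (1 / 4 : ℝ)) ^ 2
    have : 0 < (discr K : ℝ) ^ (1 / 4 : ℝ) := by positivity
    rw [h]
    nlinarith
  have hz : ((√(D : ℝ) : ℝ) : ℂ) ^ 2 = (D : ℂ) := by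
    rw [← Complex.ofReal_pow, Real.sq_sqrt hD0.le, Complex.ofReal_intCast]
  obtain ⟨φ, hφ⟩ := exists_embedding_apply_eq hD1 hD hs hz
  obtain ⟨ψ, hψ⟩ := exists_embedding_apply_eq hD1 hD hs (z := -((√(D : ℝ) : ℝ) : ℂ))
    (by rw [neg_sq, hz])
  have hne : InfinitePlace.mk φ ≠ InfinitePlace.mk ψ := by
    rw [Ne, InfinitePlace.mk_eq_iff,
      (ComplexEmbedding.isReal_iff.mp (IsTotallyReal.complexEmbedding_isReal φ)), or_self]
    rintro rfl
    have h0 : ((√(D : ℝ) : ℝ) : ℂ) = 0 := by linear_combination (hφ.symm.trans hψ) / 2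
    rw [Complex.ofReal_eq_zero] at h0
    exact (Real.sqrt_pos.mpr hD0).ne' h0
  let S : Finset (InfinitePlace K) := {InfinitePlace.mk φ, InfinitePlace.mk ψ}
  have hcard : Fintype.card (InfinitePlace K) = 4 := by
    rw [InfinitePlace.card_eq_nrRealPlaces_add_nrComplexPlaces,
      IsTotallyReal.nrComplexPlaces_eq_zero, add_zero, ← IsTotallyReal.finrank, h4]
  have hScard : Sᶜ.card = 2 := by
    rw [Finset.card_compl, hcard, Finset.card_pair hne]
  obtain ⟨a, ha0, ha⟩ := IsTotallyReal.exists_lt_of_sqrt_discr_lt_prod (K := K)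
    (fun w => if w ∈ S then 1 else T) (by
      have : ∏ w, (((if w ∈ S then 1 else T : NNReal)) : ℝ) = (T : ℝ) ^ 2 := by
        rw [← Finset.prod_mul_prod_compl S, Finset.prod_congr rfl (g := fun _ => (1 : ℝ)) fun w hw =>
          by rw [if_pos hw]; rfl, Finset.prod_const_one, one_mul, Finset.prod_congr rfl
          (g := fun _ => (T : ℝ)) fun w hw => by rw [if_neg (Finset.mem_compl.mp hw)],
          Finset.prod_const, hScard]
      rw [this]
      exact hTsq)
  refine ⟨a, fun hmem => ?_, fun w => ?_⟩
  -- On `ℚ(√D)` every embedding agrees with `φ` or `ψ`, according to the sign of `√D`.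
  · have hlt : ∀ w : InfinitePlace K, w (a : K) < 1 := by
      have h1 : ‖φ a‖ < 1 := by simpa [S] using ha (InfinitePlace.mk φ)
      have h2 : ‖ψ a‖ < 1 := by simpa [S] using ha (InfinitePlace.mk ψ)
      intro w
      rw [← InfinitePlace.norm_embedding_eq]
      have hw : w.embedding s ^ 2 = ((√(D : ℝ) : ℝ) : ℂ) ^ 2 := by
        rw [hz, ← map_pow, hs, map_intCast]
      rcases sq_eq_sq_iff_eq_or_eq_neg.mp hw with h | h
      · rwa [map_eq_of_mem_adjoin (h.trans hφ.symm) hmem]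
      · rwa [map_eq_of_mem_adjoin (h.trans hψ.symm) hmem]
    exact (InfinitePlace.one_le_of_lt_one ha0 (w := InfinitePlace.mk φ) fun z _ => hlt z).not_gt
      (hlt _)
  · refine (ha w).trans_le ?_
    split_ifs
    · exact hT1.le
    · exact le_rfl

theorem exists_isTotallyPositive_trace_lt {D : ℤ} (hD1 : 1 < D) (hD : Squarefree D)
    (h4 : finrank ℚ K = 4) {s : K} (hs : s ^ 2 = (D : K)) :
    ∃ α : 𝓞 K, IsTotallyPositive (α : K) ∧ (α : K) ∉ ℚ⟮s⟯ ∧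
      √(1 / (48 * D)) * (discr K : ℝ) ^ (1 / 4 : ℝ) < ((Algebra.trace ℚ K (α : K) : ℚ) : ℝ) ∧
      ((Algebra.trace ℚ K (α : K) : ℚ) : ℝ) < 20 * (discr K : ℝ) ^ (1 / 4 : ℝ) := by
  obtain ⟨a, ha, hlt⟩ := exists_notMem_adjoin_forall_lt hD1 hD h4 hs
  have hΔ : (1 : ℝ) ≤ discr K := by exact_mod_cast IsTotallyReal.discr_pos (K := K)
  set T : ℝ := (discr K : ℝ) ^ (1 / 4 : ℝ) with hT
  have hT1 : 1 ≤ T := Real.one_le_rpow hΔ (by norm_num)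
  set n := ⌈2 * T⌉₊
  have hn1 : 2 * T ≤ n := Nat.le_ceil _
  have hn2 : (n : ℝ) < 2 * T + 1 := Nat.ceil_lt_add_one (by positivity)
  have hbd : ∀ σ : K →+* ℂ, ‖σ a‖ < 2 * T := fun σ => hlt (InfinitePlace.mk σ)
  have hcoe : ((a + n : 𝓞 K) : K) = (a : K) + n := by simp
  -- Conjugates stay below `2T + (2T + 1) ≤ 5T`; summing four of them gives the constant 20.
  have hre : ∀ σ : K →ₐ[ℚ] ℂ, 0 < (σ (a + n : 𝓞 K)).re ∧ (σ (a + n : 𝓞 K)).re < 5 * T := by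
    intro σ
    have h1 := abs_lt.mp ((Complex.abs_re_le_norm _).trans_lt (hbd (σ : K →+* ℂ)))
    rw [hcoe, map_add, map_natCast, Complex.add_re, Complex.natCast_re]
    simp only [RingHom.coe_coe] at h1
    constructor <;> linarith
  have hnot : ((a + n : 𝓞 K) : K) ∉ ℚ⟮s⟯ := by
    intro h
    refine ha ?_
    have := sub_mem h (IntermediateField.natCast_mem ℚ⟮s⟯ n)
    rwa [hcoe, add_sub_cancel_right] at this
  have hcard : Fintype.card (K →ₐ[ℚ] ℂ) = 4 := by rw [AlgHom.card, h4]
  refine ⟨a + n, fun φ => ?_, hnot, ?_, ?_⟩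
  · have := (hre (Complex.ofRealHom.comp φ).toRatAlgHom).1
    simpa using this
  · have h := discr_rpow_lt_trace_sq hD1 hD h4 hs _ hnot
    rw [IsTotallyReal.trace_sq] at h
    rw [trace_eq_sum_re]
    refine lt_of_pow_lt_pow_left₀ 2 (Finset.sum_nonneg fun σ _ => (hre σ).1.le) ?_
    -- As all conjugates are positive, `Tr(α²) ≤ Tr(α)²`; hence the square root in the lower
    -- constant.
    have hsum := Finset.sum_sq_le_sq_sum_of_nonneg (s := Finset.univ)
      (f := fun σ : K →ₐ[ℚ] ℂ => (σ (a + n : 𝓞 K)).re) fun σ _ => (hre σ).1.le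
    refine lt_of_eq_of_lt ?_ (h.trans_le hsum)
    have hD0 : (0 : ℝ) < D := by exact_mod_cast (by lia : 0 < D)
    rw [mul_pow, Real.sq_sqrt (by positivity), hT, ← Real.rpow_natCast, ← Real.rpow_mul
      (by linarith)]
    norm_num
  · rw [trace_eq_sum_re]
    have : Nonempty (K →ₐ[ℚ] ℂ) := Fintype.card_pos_iff.mp (by rw [hcard]; norm_num)
    refine (Finset.sum_lt_sum_of_nonempty Finset.univ_nonempty fun σ _ => (hre σ).2).trans_eq ?_
    rw [Finset.sum_const, Finset.card_univ, hcard, nsmul_eq_mul]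
    push_cast
    ring

end NumberField

theorem proposition5p3 (D : ℤ) (hD1 : 1 < D) (hD : Squarefree D) :
    (∃ c C : ℝ, 0 < c ∧ 0 < C ∧
      ∀ (K : Type u) [Field K] [NumberField K] [IsTotallyReal K],
        Module.finrank ℚ K = 4 → ∀ s : K, s ^ 2 = (D : K) →
          ∃ α : 𝓞 K, IsTotallyPositive (α : K) ∧ (α : K) ∉ ℚ⟮s⟯ ∧
            c * (discr K : ℝ) ^ (1 / 4 : ℝ) < ((Algebra.trace ℚ K (α : K) : ℚ) : ℝ) ∧
            ((Algebra.trace ℚ K (α : K) : ℚ) : ℝ) < C * (discr K : ℝ) ^ (1 / 4 : ℝ)) ∧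
    (∃ c : ℝ, 0 < c ∧
      ∀ (K : Type u) [Field K] [NumberField K] [IsTotallyReal K],
        Module.finrank ℚ K = 4 → ∀ s : K, s ^ 2 = (D : K) →
          ∀ β : 𝓞 K, (β : K) ∉ ℚ⟮s⟯ →
            c * (discr K : ℝ) ^ (1 / 2 : ℝ) <
              ((Algebra.trace ℚ K ((β : K) ^ 2) : ℚ) : ℝ)) := by
  have hD0 : (0 : ℝ) < D := by exact_mod_cast (by lia : 0 < D)
  exact ⟨⟨√(1 / (48 * D)), 20, by positivity, by norm_num,
      fun K _ _ _ h4 s hs => exists_isTotallyPositive_trace_lt hD1 hD h4 hs⟩,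
    ⟨1 / (48 * D), by positivity,
      fun K _ _ _ h4 s hs β hβ => discr_rpow_lt_trace_sq hD1 hD h4 hs β hβ⟩⟩
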